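/- Let $G$ be a finite, simple, connected, regular graph, and let $r$ be a positive integer such that the diameter of $G$ is at least $r$. Let $G^r$ denote the graph on the vertex set of $G$ in which two distinct vertices are adjacent whenever their distance in $G$ is at most $r$, and let $e(H)$ denote the number of edges of a graph $H$. (a) If $r\equiv 0 \pmod 3$, then $$\frac{e(G^r)}{e(G)}\ \ge\ \frac{r+3}{3}-\frac{3}{2(r+3)}.$$ (b) If $r\not\equiv 0 \pmod 3$, then $$\frac{e(G^r)}{e(G)}\ \ge\ \left\lceil \frac r3\right\rceil .$$ -/

import Mathlib

/-- The `r`-th power of a graph `G`: same vertices, and two distinct vertices are adjacent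
whenever their distance in `G` is at most `r` (`edist` is infinite between vertices in
different components). -/
def graphPower {V : Type*} (G : SimpleGraph V) (r : ℕ) : SimpleGraph V where
  Adj x y := x ≠ y ∧ G.edist x y ≤ (r : ℕ∞)
  symm := ⟨fun _ _ h => ⟨h.1.symm, by rw [SimpleGraph.edist_comm]; exact h.2⟩⟩
  loopless := ⟨fun _ h => h.1 rfl⟩

/-- The number of edges `e(G)` of a graph. -/
noncomputable def numEdges {V : Type*} (G : SimpleGraph V) : ℕ :=
  G.edgeSet.ncard

/-! Summing degrees, `2 e(G^r) + n` is the sum of the sizes of the balls `B(v, r)`, so everything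
reduces to bounding balls. Closed neighbourhoods of every third vertex of a geodesic are disjoint
and have `d + 1` elements each. For `r = 3k + 1` or `3k + 2` this puts `(k + 1)(d + 1)` vertices
into every ball, which is (b).

For `r = 3k` the last neighbourhood may stick out, so single balls can be small and only the average
is bounded. Centres of small balls form clusters: two of them are within 2 or at least `3k` apart
(`HasSmallBall.dist_le_two_or`). In a cluster of `c` centres each ball lacks at most `d + 1 - c`
vertices, in total at most `c(d + 1 - c) ≤ (d + 1)²/4` (`exists_isFarFamily_deficit_le`). With one
representative per cluster, balls of about half the radius show that there are at most `2n / ((k +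
1)(d + 1))` clusters, up to a term paid by the excess of large balls (`IsFarFamily.card_mul_le`).
Hence deficit minus excess is at most `n(d + 1) / (2(k + 1))`, the source of the term `3 / (2(r +
3))`. -/

namespace SimpleGraph

/-! ### Geodesics and packings of closed neighbourhoods. -/

variable {V : Type*} {G : SimpleGraph V}

/-- `p` restricted to `0, …, L` is a geodesic starting at `v`. -/
def IsGeodesicFrom (G : SimpleGraph V) (v : V) (L : ℕ) (p : ℕ → V) : Prop :=
  p 0 = v ∧ ∀ i j, i ≤ j → j ≤ L → G.dist (p i) (p j) = j - i

lemma Connected.exists_isGeodesicFrom (hconn : G.Connected) (u v : V) :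
    ∃ p : ℕ → V, G.IsGeodesicFrom u (G.dist u v) p ∧ p (G.dist u v) = v := by
  obtain ⟨w, hw⟩ := hconn.exists_walk_length_eq_dist u v
  have step : ∀ i n, G.dist (w.getVert i) (w.getVert (i + n)) ≤ n := by
    intro i n
    induction n with
    | zero => simp
    | succ n ih =>
      have h1 := hconn.dist_triangle (u := w.getVert i) (v := w.getVert (i + n))
        (w := w.getVert (i + (n + 1)))
      have h2 : G.dist (w.getVert (i + n)) (w.getVert (i + (n + 1))) ≤ 1 := by
        by_cases h : i + n < w.length
        · exact (dist_eq_one_iff_adj.2 (w.adj_getVert_succ h)).le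
        · rw [w.getVert_of_length_le (by omega), w.getVert_of_length_le (by omega)]
          simp
      omega
  have hL : w.getVert (G.dist u v) = v := by rw [← hw, w.getVert_length]
  refine ⟨w.getVert, ⟨w.getVert_zero, fun i j hij hj => ?_⟩, hL⟩
  have h1 := step 0 i
  have h2 := step i (j - i)
  have h3 := step j (G.dist u v - j)
  rw [show i + (j - i) = j by omega] at h2
  rw [show j + (G.dist u v - j) = G.dist u v by omega, hL] at h3
  rw [zero_add, w.getVert_zero] at h1
  have h4 := hconn.dist_triangle (u := u) (v := w.getVert i) (w := v)
  have h5 := hconn.dist_triangle (u := w.getVert i) (v := w.getVert j) (w := v)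
  omega

lemma IsGeodesicFrom.mono {v : V} {L M : ℕ} {p : ℕ → V} (hp : G.IsGeodesicFrom v L p)
    (h : M ≤ L) : G.IsGeodesicFrom v M p :=
  ⟨hp.1, fun i j hij hj => hp.2 i j hij (hj.trans h)⟩

lemma IsGeodesicFrom.dist_left {v : V} {L i : ℕ} {p : ℕ → V} (hp : G.IsGeodesicFrom v L p)
    (h : i ≤ L) : G.dist v (p i) = i := by
  have := hp.2 0 i (Nat.zero_le _) h
  rwa [hp.1, Nat.sub_zero] at this

lemma exists_isGeodesicFrom_of_le_diam [Finite V] (hconn : G.Connected) {r : ℕ} (h : r ≤ G.diam) :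
    ∃ v p, G.IsGeodesicFrom v r p := by
  have : Nonempty V := hconn.nonempty
  obtain ⟨u, v, huv⟩ := G.exists_dist_eq_diam
  obtain ⟨p, hp, -⟩ := hconn.exists_isGeodesicFrom u v
  exact ⟨u, p, hp.mono (h.trans huv.ge)⟩

variable [Fintype V]

open Classical in
/-- The closed ball of radius `ρ` around `v` in the graph metric. -/
noncomputable def distBall (G : SimpleGraph V) (v : V) (ρ : ℕ) : Finset V :=
  Finset.univ.filter fun w => G.dist v w ≤ ρ

lemma mem_distBall {v w : V} {ρ : ℕ} : w ∈ G.distBall v ρ ↔ G.dist v w ≤ ρ := by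
  simp [distBall]

lemma card_distBall_one [DecidableRel G.Adj] (hconn : G.Connected) {d : ℕ}
    (hreg : G.IsRegularOfDegree d) (v : V) : (G.distBall v 1).card = d + 1 := by
  classical
  have : G.distBall v 1 = insert v (G.neighborFinset v) := by
    ext w
    rw [mem_distBall, Nat.le_one_iff_eq_zero_or_eq_one, hconn.dist_eq_zero_iff, dist_eq_one_iff_adj]
    simp [eq_comm]
  rw [this, Finset.card_insert_of_notMem (by simp), card_neighborFinset_eq_degree, hreg v]

/-- Closed neighbourhoods of vertices pairwise at distance at least three are disjoint. -/
lemma mul_succ_le_card_of_pairwise_dist [DecidableRel G.Adj] (hconn : G.Connected) {d : ℕ}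
    (hreg : G.IsRegularOfDegree d) {ι : Type*} (s : Finset ι) (x : ι → V) (T : Finset V)
    (hsep : ∀ i ∈ s, ∀ j ∈ s, i ≠ j → 3 ≤ G.dist (x i) (x j))
    (hsub : ∀ i ∈ s, G.distBall (x i) 1 ⊆ T) : s.card * (d + 1) ≤ T.card := by
  classical
  have hdisj : (s : Set ι).PairwiseDisjoint fun i => G.distBall (x i) 1 := by
    intro i hi j hj hij
    rw [Function.onFun, Finset.disjoint_left]
    intro w hw hw'
    rw [mem_distBall] at hw hw'
    have h1 := hsep i hi j hj hij
    have h2 := hconn.dist_triangle (u := x i) (v := w) (w := x j)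
    rw [G.dist_comm (u := w)] at h2
    omega
  calc s.card * (d + 1) = (s.biUnion fun i => G.distBall (x i) 1).card := by
        rw [Finset.card_biUnion hdisj, Finset.sum_congr rfl
          fun i _ => card_distBall_one hconn hreg (x i)]
        simp
    _ ≤ T.card := Finset.card_le_card (Finset.biUnion_subset.2 hsub)

lemma distBall_one_subset (hconn : G.Connected) {v x : V} {ρ : ℕ} (h : G.dist v x + 1 ≤ ρ) :
    G.distBall x 1 ⊆ G.distBall v ρ := by
  intro w hw
  rw [mem_distBall] at hw ⊢
  have := hconn.dist_triangle (u := v) (v := x) (w := w)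
  omega

/-- Packing of closed neighbourhoods into a ball, indexed by an initial segment. -/
lemma mul_succ_le_card_distBall [DecidableRel G.Adj] (hconn : G.Connected) {d : ℕ}
    (hreg : G.IsRegularOfDegree d) {v : V} {ρ : ℕ} (n : ℕ) (x : ℕ → V)
    (hsep : ∀ i j, i < j → j < n → 3 ≤ G.dist (x i) (x j))
    (hdist : ∀ i, i < n → G.dist v (x i) + 1 ≤ ρ) :
    n * (d + 1) ≤ (G.distBall v ρ).card := by
  have := mul_succ_le_card_of_pairwise_dist hconn hreg (Finset.range n) x (G.distBall v ρ) ?_ ?_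
  · simpa using this
  · intro i hi j hj hij
    rw [Finset.mem_range] at hi hj
    rcases lt_or_gt_of_ne hij with h | h
    · exact hsep i j h hj
    · rw [dist_comm]; exact hsep j i h hi
  · intro i hi
    exact distBall_one_subset hconn (hdist i (Finset.mem_range.1 hi))

/-- Along a geodesic of length `3 * i` one packs `i + 1` closed neighbourhoods. -/
lemma IsGeodesicFrom.mul_succ_le_card_distBall [DecidableRel G.Adj] (hconn : G.Connected) {d : ℕ}
    (hreg : G.IsRegularOfDegree d) {v : V} {L i ρ : ℕ} {p : ℕ → V} (hp : G.IsGeodesicFrom v L p)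
    (hi : 3 * i ≤ L) (hρ : 3 * i + 1 ≤ ρ) : (i + 1) * (d + 1) ≤ (G.distBall v ρ).card := by
  refine SimpleGraph.mul_succ_le_card_distBall hconn hreg (i + 1) (fun l => p (3 * l)) ?_ ?_
  · intro a b hab hb
    have := hp.2 (3 * a) (3 * b) (by omega) (by omega)
    omega
  · intro a ha
    have := hp.dist_left (i := 3 * a) (by omega)
    omega

/-- Either a geodesic of length `r` starts at `v`, or the ball of radius `r` around `v` is
everything. -/
lemma exists_isGeodesicFrom_or_distBall_eq_univ (hconn : G.Connected) (v : V) (r : ℕ) :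
    (∃ p, G.IsGeodesicFrom v r p) ∨ G.distBall v r = Finset.univ := by
  by_cases h : ∃ w, r ≤ G.dist v w
  · obtain ⟨w, hw⟩ := h
    obtain ⟨p, hp, -⟩ := hconn.exists_isGeodesicFrom v w
    exact Or.inl ⟨p, hp.mono hw⟩
  · right
    push Not at h
    ext w
    simpa [mem_distBall] using (h w).le

end SimpleGraph

/-! ### Small balls of radius `3 * k` and the position of their centres. -/

namespace SimpleGraph

variable {V : Type*} [Fintype V] {G : SimpleGraph V}

/-- The ball of radius `3 * k` around `v` has fewer than `(k + 1) * (d + 1)` elements. -/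
def HasSmallBall (G : SimpleGraph V) (d k : ℕ) (v : V) : Prop :=
  (G.distBall v (3 * k)).card < (k + 1) * (d + 1)

section SmallBalls

variable {d k : ℕ}

lemma HasSmallBall.exists_isGeodesicFrom (hconn : G.Connected)
    (hn : (k + 1) * (d + 1) ≤ Fintype.card V) {v : V} (hv : G.HasSmallBall d k v) :
    ∃ p, G.IsGeodesicFrom v (3 * k) p := by
  rcases exists_isGeodesicFrom_or_distBall_eq_univ hconn v (3 * k) with h | h
  · exact h
  · rw [HasSmallBall, h, Finset.card_univ] at hv
    omega

variable [DecidableRel G.Adj]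

/-- A packing family of `k + 1` points cannot lie close to the centre of a small ball. -/
lemma HasSmallBall.false_of_packing (hconn : G.Connected) (hreg : G.IsRegularOfDegree d)
    {v : V} (hv : G.HasSmallBall d k v) (x : ℕ → V)
    (hsep : ∀ i j, i < j → j < k + 1 → 3 ≤ G.dist (x i) (x j))
    (hdist : ∀ i, i < k + 1 → G.dist v (x i) + 1 ≤ 3 * k) : False := by
  have := mul_succ_le_card_distBall hconn hreg (k + 1) x hsep hdist
  rw [HasSmallBall] at hv
  omega

lemma HasSmallBall.false_of_isGeodesicFrom (hconn : G.Connected) (hreg : G.IsRegularOfDegree d)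
    {v y : V} (hy : G.HasSmallBall d k y) {q : ℕ → V} (hq : G.IsGeodesicFrom v (3 * k) q)
    (h : ∀ i ≤ k, G.dist y (q (3 * i)) + 1 ≤ 3 * k) : False := by
  refine hy.false_of_packing hconn hreg (fun i => q (3 * i)) ?_ fun i hi => h i (by omega)
  intro i j hij hj
  have := hq.2 (3 * i) (3 * j) (by omega) (by omega)
  omega

/-- Centres of small balls are either close to each other or far apart. -/
lemma HasSmallBall.dist_le_two_or (hconn : G.Connected) (hreg : G.IsRegularOfDegree d)
    (hn : (k + 1) * (d + 1) ≤ Fintype.card V) {v y : V} (hv : G.HasSmallBall d k v)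
    (hy : G.HasSmallBall d k y) : G.dist v y ≤ 2 ∨ 3 * k ≤ G.dist v y := by
  by_contra! hcon
  obtain ⟨q, hq⟩ := hv.exists_isGeodesicFrom hconn hn
  -- Otherwise all of `q 0, q 3, …, q (3 * k)` lie within `2 + 3 * (k - 1)` of `y`.
  have hfar : ∀ i, i < k → 3 ≤ G.dist y (q (3 * i)) := by
    intro i hi
    rcases Nat.eq_zero_or_pos i with rfl | hi0
    · rw [Nat.mul_zero, hq.1, dist_comm]
      omega
    · by_contra! hlt
      refine hy.false_of_isGeodesicFrom hconn hreg hq fun l hl => ?_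
      have h1 := hconn.dist_triangle (u := y) (v := q (3 * i)) (w := q (3 * l))
      rcases le_total i l with h | h
      · have := hq.2 (3 * i) (3 * l) (by omega) (by omega)
        omega
      · have := hq.2 (3 * l) (3 * i) (by omega) (by omega)
        rw [G.dist_comm] at this
        omega
  -- `y` replaces `q (3 * k)`, whose closed neighbourhood need not fit into the ball.
  refine hv.false_of_packing hconn hreg (fun i => if i < k then q (3 * i) else y) ?_ ?_
  · intro i j hij hj
    have hi : i < k := by omega
    simp only [hi, if_true]
    split_ifs with h
    · have := hq.2 (3 * i) (3 * j) (by omega) (by omega)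
      omega
    · rw [G.dist_comm]
      exact hfar i hi
  · intro i hi
    split_ifs with h
    · rw [hq.dist_left (by omega)]
      omega
    · omega

/-- A centre of a small ball near `v` is no closer than `v` to the points of a long geodesic
from `v`. -/
lemma HasSmallBall.le_dist_of_isGeodesicFrom (hconn : G.Connected)
    (hreg : G.IsRegularOfDegree d) {v u : V} (hu : G.HasSmallBall d k u) (huv : G.dist v u ≤ 2)
    {q : ℕ → V} (hq : G.IsGeodesicFrom v (3 * k) q) {j : ℕ} (hj : j ≤ 3 * k) :
    j ≤ G.dist u (q j) := by
  by_contra! hlt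
  -- The shortcut through `q j` brings `q (3 * k)` within `3 * k - 1` of `u`; the earlier points are
  -- within `2 + 3 * (k - 1)` anyway.
  refine hu.false_of_isGeodesicFrom hconn hreg hq fun i hi => ?_
  rcases hi.lt_or_eq with h | rfl
  · have h1 := hconn.dist_triangle (u := u) (v := v) (w := q (3 * i))
    have h2 := hq.dist_left (i := 3 * i) (by omega)
    rw [G.dist_comm (u := u) (v := v)] at h1
    omega
  · have h1 := hconn.dist_triangle (u := u) (v := q j) (w := q (3 * i))
    have h2 := hq.2 j (3 * i) hj le_rfl
    omega

/-- The triangle inequality gives 4, and the gap up to `3 * k` does the rest unless `k = 1`; then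
`v` and `y` themselves form a packing around `u`. -/
lemma HasSmallBall.dist_le_two_trans (hk : 0 < k) (hconn : G.Connected)
    (hreg : G.IsRegularOfDegree d) (hn : (k + 1) * (d + 1) ≤ Fintype.card V) {u v y : V}
    (hu : G.HasSmallBall d k u) (hv : G.HasSmallBall d k v) (hy : G.HasSmallBall d k y)
    (huv : G.dist v u ≤ 2) (huy : G.dist u y ≤ 2) : G.dist v y ≤ 2 := by
  rcases hv.dist_le_two_or hconn hreg hn hy with h | h
  · exact h
  · have h1 := hconn.dist_triangle (u := v) (v := u) (w := y)
    obtain rfl : k = 1 := by omega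
    refine (hu.false_of_packing hconn hreg (fun i => if i = 0 then v else y) ?_ ?_).elim
    · intro i j hij hj
      obtain rfl : i = 0 := by omega
      obtain rfl : j = 1 := by omega
      simpa using h
    · intro i hi
      rw [G.dist_comm] at huv
      split_ifs <;> omega

/-- The ball around `v` contains, besides the centres of small balls close to `v`, another `k`
disjoint closed neighbourhoods. -/
lemma HasSmallBall.card_add_le_card_distBall (hk : 0 < k) (hconn : G.Connected)
    (hreg : G.IsRegularOfDegree d) (hn : (k + 1) * (d + 1) ≤ Fintype.card V) {v : V}
    (hv : G.HasSmallBall d k v) (C : Finset V)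
    (hC : ∀ u ∈ C, G.HasSmallBall d k u ∧ G.dist v u ≤ 2) :
    C.card + k * (d + 1) ≤ (G.distBall v (3 * k)).card := by
  classical
  obtain ⟨q, hq⟩ := hv.exists_isGeodesicFrom hconn hn
  have hCsub : C ⊆ G.distBall v (3 * k) := fun u hu => by
    rw [mem_distBall]
    have := (hC u hu).2
    omega
  -- With the shift by 2 the last neighbourhood just reaches radius `3 * k`, and every point is at
  -- distance at least 2 from each `u ∈ C`, so the neighbourhoods avoid `C`.
  have hpack := mul_succ_le_card_of_pairwise_dist hconn hreg (Finset.range k)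
    (fun i => q (3 * i + 2)) (G.distBall v (3 * k) \ C) ?_ ?_
  · rw [Finset.card_range, Finset.card_sdiff_of_subset hCsub] at hpack
    have := Finset.card_le_card hCsub
    omega
  · intro i hi j hj hij
    rw [Finset.mem_range] at hi hj
    rcases lt_or_gt_of_ne hij with h | h
    · have := hq.2 (3 * i + 2) (3 * j + 2) (by omega) (by omega)
      omega
    · have := hq.2 (3 * j + 2) (3 * i + 2) (by omega) (by omega)
      rw [G.dist_comm] at this
      omega
  · intro i hi w hw
    rw [Finset.mem_range] at hi
    have hdist := hq.dist_left (i := 3 * i + 2) (by omega)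
    refine Finset.mem_sdiff.2 ⟨distBall_one_subset hconn (by omega) hw, fun hwC => ?_⟩
    have h1 := (hC w hwC).1.le_dist_of_isGeodesicFrom hconn hreg (hC w hwC).2 hq
      (j := 3 * i + 2) (by omega)
    rw [mem_distBall, G.dist_comm] at hw
    omega

lemma HasSmallBall.mul_succ_le_card_distBall (hconn : G.Connected)
    (hreg : G.IsRegularOfDegree d) (hn : (k + 1) * (d + 1) ≤ Fintype.card V) {v : V}
    (hv : G.HasSmallBall d k v) {i ρ : ℕ} (hi : i ≤ k) (hρ : 3 * i + 1 ≤ ρ) :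
    (i + 1) * (d + 1) ≤ (G.distBall v ρ).card := by
  obtain ⟨q, hq⟩ := hv.exists_isGeodesicFrom hconn hn
  exact hq.mul_succ_le_card_distBall hconn hreg (by omega) hρ

/-- All geodesics leaving a small ball pass through nearly the same place: at depth `3 * k - 1` two
of them are within 2, or both points could join a packing of `k + 1` neighbourhoods. -/
lemma HasSmallBall.dist_add_le (hk : 2 ≤ k) (hconn : G.Connected)
    (hreg : G.IsRegularOfDegree d) {v y z : V}
    (hv : G.HasSmallBall d k v) (hvy : 3 * k ≤ G.dist v y) (hvz : 3 * k ≤ G.dist v z) :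
    G.dist y z + 6 * k ≤ G.dist v y + G.dist v z + 4 := by
  obtain ⟨p, hp, hpy⟩ := hconn.exists_isGeodesicFrom v y
  obtain ⟨q, hq, hqz⟩ := hconn.exists_isGeodesicFrom v z
  have hclose : G.dist (p (3 * k - 1)) (q (3 * k - 1)) ≤ 2 := by
    by_contra! hlt
    have hpd := hp.dist_left (i := 3 * k - 1) (by omega)
    have hqd := hq.dist_left (i := 3 * k - 1) (by omega)
    refine hv.false_of_packing hconn hreg (fun i => if i < k - 1 then p (3 * i) else
      if i < k then p (3 * k - 1) else q (3 * k - 1)) ?_ ?_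
    · intro i j hij hj
      by_cases hi : i < k - 1
      · rw [if_pos hi]
        have hpi := hp.dist_left (i := 3 * i) (by omega)
        split_ifs with h1 h2
        · have := hp.2 (3 * i) (3 * j) (by omega) (by omega)
          omega
        · have := hp.2 (3 * i) (3 * k - 1) (by omega) (by omega)
          omega
        · have := hconn.dist_triangle (u := v) (v := p (3 * i)) (w := q (3 * k - 1))
          omega
      · rw [if_neg hi, if_pos (by omega), if_neg (by omega), if_neg (by omega)]
        omega
    · intro i hi
      split_ifs with h1 h2
      · rw [hp.dist_left (by omega)]
        omega
      · omega
      · omega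
  have h1 := hp.2 (3 * k - 1) _ (by omega) le_rfl
  have h2 := hq.2 (3 * k - 1) _ (by omega) le_rfl
  rw [hpy, G.dist_comm] at h1
  rw [hqz] at h2
  have h3 := hconn.dist_triangle (u := y) (v := p (3 * k - 1)) (w := z)
  have h4 := hconn.dist_triangle (u := p (3 * k - 1)) (v := q (3 * k - 1)) (w := z)
  omega

/-- Two balls whose centres are joined by a geodesic of length about `6 * j` contain together
`2 * j + 1` disjoint closed neighbourhoods. -/
lemma mul_succ_le_card_distBall_union [DecidableEq V] (hconn : G.Connected)
    (hreg : G.IsRegularOfDegree d) {v y : V} {j : ℕ} (h1 : 6 * j ≤ G.dist v y)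
    (h2 : G.dist v y ≤ 6 * j + 1) : (2 * j + 1) * (d + 1) ≤
      (G.distBall v (3 * j + 1) ∪ G.distBall y (3 * j + 1)).card := by
  obtain ⟨p, hp, hpy⟩ := hconn.exists_isGeodesicFrom v y
  have := mul_succ_le_card_of_pairwise_dist hconn hreg (Finset.range (2 * j + 1))
    (fun i => p (3 * i)) (G.distBall v (3 * j + 1) ∪ G.distBall y (3 * j + 1)) ?_ ?_
  · simpa using this
  · intro a ha b hb hab
    rw [Finset.mem_range] at ha hb
    rcases lt_or_gt_of_ne hab with h | h
    · have := hp.2 (3 * a) (3 * b) (by omega) (by omega)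
      omega
    · have := hp.2 (3 * b) (3 * a) (by omega) (by omega)
      rw [G.dist_comm] at this
      omega
  · intro i hi
    rw [Finset.mem_range] at hi
    rcases le_or_gt i j with h | h
    · have := hp.dist_left (i := 3 * i) (by omega)
      exact (distBall_one_subset hconn (by omega)).trans Finset.subset_union_left
    · have := hp.2 (3 * i) _ (by omega) le_rfl
      rw [hpy, G.dist_comm] at this
      exact (distBall_one_subset hconn (by omega)).trans Finset.subset_union_right

end SmallBalls

end SimpleGraph

/-! ### Counting far families by distributing the vertices among their members. -/

namespace SimpleGraph

variable {V : Type*} [Fintype V] {G : SimpleGraph V} [DecidableRel G.Adj] {d k j : ℕ}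

/-- The centres of small balls in `I` are pairwise far apart. -/
structure IsFarFamily (G : SimpleGraph V) (d k : ℕ) (I : Finset V) : Prop where
  small : ∀ v ∈ I, G.HasSmallBall d k v
  three_le : ∀ v ∈ I, ∀ y ∈ I, v ≠ y → 3 ≤ G.dist v y
  le_dist : ∀ v ∈ I, ∀ y ∈ I, v ≠ y → 3 * k ≤ G.dist v y

lemma IsFarFamily.card_mul_le_of_odd (hconn : G.Connected) (hreg : G.IsRegularOfDegree d)
    (hn : (2 * j + 1 + 1) * (d + 1) ≤ Fintype.card V) {I : Finset V}
    (hI : G.IsFarFamily d (2 * j + 1) I) :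
    I.card * ((j + 1) * (d + 1)) ≤ Fintype.card V := by
  classical
  have hdisj : (I : Set V).PairwiseDisjoint fun v => G.distBall v (3 * j + 1) := by
    intro v hv y hy hvy
    rw [Function.onFun, Finset.disjoint_left]
    intro w hw hw'
    rw [mem_distBall] at hw hw'
    have h1 := hI.le_dist v hv y hy hvy
    have h2 := hconn.dist_triangle (u := v) (v := w) (w := y)
    rw [G.dist_comm (u := w)] at h2
    omega
  calc I.card * ((j + 1) * (d + 1)) ≤ ∑ v ∈ I, (G.distBall v (3 * j + 1)).card := by
        rw [← smul_eq_mul]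
        exact Finset.card_nsmul_le_sum _ _ _ fun v hv =>
          (hI.small v hv).mul_succ_le_card_distBall hconn hreg hn (by omega) le_rfl
    _ = (I.biUnion fun v => G.distBall v (3 * j + 1)).card := (Finset.card_biUnion hdisj).symm
    _ ≤ Fintype.card V := Finset.card_le_univ _

/-- Adding the inequalities of `HasSmallBall.dist_add_le` centred at `v` and at `y` gives `12 * j -
4 ≤ G.dist v y`. Hence pairs closer than `6 * j + 2` have no third member beside them. -/
lemma IsFarFamily.eq_of_triple (hj : 0 < j) (hconn : G.Connected) (hreg : G.IsRegularOfDegree d)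
    {I : Finset V} (hI : G.IsFarFamily d (2 * j) I) {v y z : V} (hv : v ∈ I) (hy : y ∈ I)
    (hz : z ∈ I) (hvy : v ≠ y) (hvz : v ≠ z) (hyz : y ≠ z) (h : G.dist v y ≤ 6 * j + 2) : j = 1 ∧ G.dist v y = 8 := by
  have a1 := hI.le_dist v hv y hy hvy
  have a2 := hI.le_dist v hv z hz hvz
  have a3 := hI.le_dist y hy z hz hyz
  have b1 := (hI.small v hv).dist_add_le (by omega) hconn hreg a1 a2
  have b2 := (hI.small y hy).dist_add_le (by omega) hconn hreg (G.dist_comm ▸ a1) a3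
  have b3 := (hI.small z hz).dist_add_le (by omega) hconn hreg (G.dist_comm ▸ a2)
    (G.dist_comm ▸ a3)
  have c1 := G.dist_comm (u := y) (v := v)
  have c2 := G.dist_comm (u := z) (v := v)
  have c3 := G.dist_comm (u := z) (v := y)
  omega

open Classical in
/-- The members of `I` within distance `R` of `w`. -/
noncomputable def nearMembers (G : SimpleGraph V) (I : Finset V) (R : ℕ) (w : V) : Finset V :=
  I.filter fun v => G.dist v w ≤ R

omit [Fintype V] [DecidableRel G.Adj] in
lemma mem_nearMembers {I : Finset V} {R : ℕ} {v w : V} :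
    v ∈ G.nearMembers I R w ↔ v ∈ I ∧ G.dist v w ≤ R := by
  simp [nearMembers]

/-- A vertex near at least three members of a far family has a large ball. -/
lemma IsFarFamily.card_nearMembers_add_one_mul_le (hj : 0 < j) (hconn : G.Connected)
    (hreg : G.IsRegularOfDegree d) {I : Finset V} (hI : G.IsFarFamily d (2 * j) I) {w : V}
    (hw : 3 ≤ (G.nearMembers I (3 * j + 1) w).card) : j = 1 ∧
      ((G.nearMembers I (3 * j + 1) w).card + 1) * (d + 1) ≤ (G.distBall w 6).card := by
  classical
  -- Two near members are at most `6 * j + 2` apart, so a third one forces distance 8, split as 4 +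
  -- 4 at `w`. Then `w` itself can join the packing.
  have key : ∀ v ∈ G.nearMembers I (3 * j + 1) w, j = 1 ∧ G.dist v w = 4 := by
    intro v hv
    have hcard : 1 < ((G.nearMembers I (3 * j + 1) w).erase v).card := by
      rw [Finset.card_erase_of_mem hv]
      omega
    obtain ⟨y, hy, z, hz, hyz⟩ := Finset.one_lt_card.1 hcard
    rw [Finset.mem_erase, mem_nearMembers] at hy hz
    rw [mem_nearMembers] at hv
    have h1 := hconn.dist_triangle (u := v) (v := w) (w := y)
    rw [G.dist_comm (u := w)] at h1
    have := hI.eq_of_triple hj hconn hreg hv.1 hy.2.1 hz.2.1 hy.1.symm hz.1.symm hyz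
      (by omega)
    omega
  obtain ⟨v₀, hv₀⟩ := Finset.card_pos.1 (by omega : 0 < (G.nearMembers I (3 * j + 1) w).card)
  refine ⟨(key v₀ hv₀).1, ?_⟩
  have hwA : w ∉ G.nearMembers I (3 * j + 1) w := fun h => by simpa using (key w h).2
  rw [← Finset.card_insert_of_notMem hwA]
  refine mul_succ_le_card_of_pairwise_dist hconn hreg _ id _ ?_ ?_
  · intro a ha b hb hab
    rcases Finset.mem_insert.1 ha with rfl | ha
    · rcases Finset.mem_insert.1 hb with rfl | hb
      · exact absurd rfl hab
      · have := (key b hb).2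
        rw [G.dist_comm] at this
        simp only [id]
        omega
    · rcases Finset.mem_insert.1 hb with rfl | hb
      · have := (key a ha).2
        simp only [id]
        omega
      · exact hI.three_le a (mem_nearMembers.1 ha).1 b (mem_nearMembers.1 hb).1 hab
  · intro a ha
    refine distBall_one_subset hconn ?_
    rcases Finset.mem_insert.1 ha with rfl | ha
    · simp
    · have := (key a ha).2
      rw [G.dist_comm] at this
      simp only [id]
      omega

/-- Twice the share of a vertex received by each of the members of `I` close to it. -/
noncomputable def share (G : SimpleGraph V) (I : Finset V) (R : ℕ) (w : V) : ℕ :=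
  -- A vertex near three or more members gives away too much; its excess pays for this in
  -- `IsFarFamily.card_mul_share_mul_le`.
  if (G.nearMembers I R w).card = 2 then 1 else 2

/-- Twice the total weight received by `v`. -/
noncomputable def totalShare (G : SimpleGraph V) (I : Finset V) (R : ℕ) (v : V) : ℕ :=
  ∑ w ∈ G.distBall v R, G.share I R w

omit [Fintype V] [DecidableRel G.Adj] in
lemma one_le_share (I : Finset V) (R : ℕ) (w : V) : 1 ≤ G.share I R w := by
  rw [share]; split_ifs <;> omega

omit [Fintype V] [DecidableRel G.Adj] in
lemma share_eq_two {I : Finset V} {R : ℕ} {v w : V}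
    (h : ∀ y ∈ G.nearMembers I R w, y = v) : G.share I R w = 2 := by
  rw [share, if_neg]
  intro h2
  obtain ⟨a, ha, b, hb, hab⟩ := Finset.one_lt_card.1 (by omega : 1 < (G.nearMembers I R w).card)
  exact hab ((h a ha).trans (h b hb).symm)

omit [DecidableRel G.Adj] in
lemma sum_totalShare (I : Finset V) (R : ℕ) :
    ∑ v ∈ I, G.totalShare I R v = ∑ w, (G.nearMembers I R w).card * G.share I R w := by
  classical
  simp only [totalShare, distBall, nearMembers, Finset.card_filter, Finset.sum_mul,
    Finset.sum_filter]
  rw [Finset.sum_comm]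
  simp

/-- Vertices within `3 * j` of `v` are near no other member and count twice, those at distance `3 *
j + 1` at least once; the two balls hold `j` and `j + 1` disjoint neighbourhoods. -/
lemma IsFarFamily.le_totalShare (hj : 0 < j) (hconn : G.Connected)
    (hreg : G.IsRegularOfDegree d) (hn : (2 * j + 1) * (d + 1) ≤ Fintype.card V) {I : Finset V}
    (hI : G.IsFarFamily d (2 * j) I) {v : V} (hv : v ∈ I)
    (hfar : ∀ y ∈ I, y ≠ v → 6 * j + 2 ≤ G.dist v y) :
    (2 * j + 1) * (d + 1) ≤ G.totalShare I (3 * j + 1) v := by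
  classical
  have h1 := (hI.small v hv).mul_succ_le_card_distBall hconn hreg hn (i := j) (by omega) le_rfl
  have h2 := (hI.small v hv).mul_succ_le_card_distBall hconn hreg hn (i := j - 1) (ρ := 3 * j)
    (by omega) (by omega)
  rw [Nat.sub_add_cancel hj] at h2
  have hsub : G.distBall v (3 * j) ⊆ G.distBall v (3 * j + 1) := fun w hw => by
    rw [mem_distBall] at hw ⊢
    omega
  have h3 : (G.distBall v (3 * j)).card + (G.distBall v (3 * j + 1)).card ≤
      G.totalShare I (3 * j + 1) v := by
    rw [totalShare, ← Finset.sum_sdiff hsub, ← Finset.card_sdiff_add_card_eq_card hsub]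
    have e1 : (G.distBall v (3 * j + 1) \ G.distBall v (3 * j)).card * 1 ≤
        ∑ w ∈ G.distBall v (3 * j + 1) \ G.distBall v (3 * j), G.share I (3 * j + 1) w := by
      rw [← smul_eq_mul]
      exact Finset.card_nsmul_le_sum _ _ _ fun w _ => one_le_share _ _ _
    have e2 : (G.distBall v (3 * j)).card * 2 ≤
        ∑ w ∈ G.distBall v (3 * j), G.share I (3 * j + 1) w := by
      rw [← smul_eq_mul]
      refine Finset.card_nsmul_le_sum _ _ _ fun w hw => (share_eq_two (v := v) ?_).ge
      intro y hy
      by_contra hyv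
      rw [mem_nearMembers] at hy
      rw [mem_distBall] at hw
      have h4 := hfar y hy.1 hyv
      have h5 := hconn.dist_triangle (u := v) (v := w) (w := y)
      rw [G.dist_comm (u := w)] at h5
      omega
    omega
  linarith

lemma IsFarFamily.eq_or_eq_of_dist_lt (hj : 0 < j) (hconn : G.Connected)
    (hreg : G.IsRegularOfDegree d) {I : Finset V} (hI : G.IsFarFamily d (2 * j) I) {v y z : V}
    (hv : v ∈ I) (hy : y ∈ I) (hz : z ∈ I) (hvy : v ≠ y) (h : G.dist v y < 6 * j + 2) :
    z = v ∨ z = y := by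
  by_contra! hne
  have := hI.eq_of_triple hj hconn hreg hv hy hz hvy hne.1.symm hne.2.symm h.le
  omega

lemma IsFarFamily.share_eq_two_of_dist_lt (hj : 0 < j) (hconn : G.Connected)
    (hreg : G.IsRegularOfDegree d) {I : Finset V} (hI : G.IsFarFamily d (2 * j) I) {v y w : V}
    (hv : v ∈ I) (hy : y ∈ I) (hvy : v ≠ y) (h : G.dist v y < 6 * j + 2)
    (hyw : ¬ G.dist y w ≤ 3 * j + 1) :
    G.share I (3 * j + 1) w = 2 := by
  refine share_eq_two (v := v) fun z hz => ?_
  rw [mem_nearMembers] at hz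
  refine (hI.eq_or_eq_of_dist_lt hj hconn hreg hv hy hz.1 hvy h).resolve_right ?_
  rintro rfl
  exact hyw hz.2

/-- No third member interferes with a close pair, so each vertex of the union of the two balls
contributes at least 2 to the pair. -/
lemma IsFarFamily.le_totalShare_add (hj : 0 < j) (hconn : G.Connected)
    (hreg : G.IsRegularOfDegree d) {I : Finset V} (hI : G.IsFarFamily d (2 * j) I) {v y : V}
    (hv : v ∈ I) (hy : y ∈ I) (hvy : v ≠ y) (h : G.dist v y < 6 * j + 2) :
    2 * ((2 * j + 1) * (d + 1)) ≤
      G.totalShare I (3 * j + 1) v + G.totalShare I (3 * j + 1) y := by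
  classical
  have h1 := mul_succ_le_card_distBall_union hconn hreg (v := v) (y := y) (j := j)
    (by have := hI.le_dist v hv y hy hvy; omega) (by omega)
  have h2 : ∑ w, (if w ∈ G.distBall v (3 * j + 1) ∪ G.distBall y (3 * j + 1) then 2 else 0) ≤
      G.totalShare I (3 * j + 1) v + G.totalShare I (3 * j + 1) y := by
    simp only [totalShare, distBall, Finset.sum_filter]
    rw [← Finset.sum_add_distrib]
    refine Finset.sum_le_sum fun w _ => ?_
    have hs := one_le_share (G := G) I (3 * j + 1) w
    simp only [Finset.mem_union, Finset.mem_filter, Finset.mem_univ, true_and]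
    by_cases hvw : G.dist v w ≤ 3 * j + 1 <;> by_cases hyw : G.dist y w ≤ 3 * j + 1
    · simp only [hvw, hyw, or_self, if_true]
      omega
    · simp [hvw, hyw, hI.share_eq_two_of_dist_lt hj hconn hreg hv hy hvy h hyw]
    · simp [hvw, hyw, hI.share_eq_two_of_dist_lt hj hconn hreg hy hv hvy.symm
        (by rwa [G.dist_comm]) hvw]
    · simp [hvw, hyw]
  rw [Finset.sum_ite_mem, Finset.univ_inter, Finset.sum_const, smul_eq_mul] at h2
  linarith

lemma IsFarFamily.card_mul_le_sum_totalShare (hj : 0 < j) (hconn : G.Connected)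
    (hreg : G.IsRegularOfDegree d) (hn : (2 * j + 1) * (d + 1) ≤ Fintype.card V) {I : Finset V}
    (hI : G.IsFarFamily d (2 * j) I) :
    I.card * ((2 * j + 1) * (d + 1)) ≤ ∑ v ∈ I, G.totalShare I (3 * j + 1) v := by
  classical
  -- `σ` swaps the members of each close pair and fixes the others; summing over `v` and `σ v`
  -- treats both cases at once.
  have hex : ∀ v, ∃ y, v ∈ I →
      y ∈ I ∧ ((y ≠ v ∧ G.dist v y < 6 * j + 2) ∨
        (y = v ∧ ∀ z ∈ I, z ≠ v → 6 * j + 2 ≤ G.dist v z)) := by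
    intro v
    by_cases h : ∃ y ∈ I, y ≠ v ∧ G.dist v y < 6 * j + 2
    · obtain ⟨y, hy, h⟩ := h
      exact ⟨y, fun _ => ⟨hy, Or.inl h⟩⟩
    · push Not at h
      exact ⟨v, fun hv => ⟨hv, Or.inr ⟨rfl, h⟩⟩⟩
  choose σ hσ using hex
  have hinv : ∀ v ∈ I, σ (σ v) = v := by
    intro v hv
    obtain ⟨hy, ⟨hne, hlt⟩ | ⟨heq, -⟩⟩ := hσ v hv
    · rw [G.dist_comm] at hlt
      obtain ⟨hz, ⟨hne', -⟩ | ⟨-, hall⟩⟩ := hσ (σ v) hy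
      · exact (hI.eq_or_eq_of_dist_lt hj hconn hreg hy hv hz hne hlt).resolve_left hne'
      · have := hall v hv hne.symm
        omega
    · rw [heq, heq]
  have hsum : ∑ v ∈ I, G.totalShare I (3 * j + 1) (σ v) =
      ∑ v ∈ I, G.totalShare I (3 * j + 1) v :=
    Finset.sum_nbij' σ σ (fun v hv => (hσ v hv).1) (fun v hv => (hσ v hv).1) hinv hinv
      fun _ _ => rfl
  have hle : I.card * (2 * ((2 * j + 1) * (d + 1))) ≤
      ∑ v ∈ I, (G.totalShare I (3 * j + 1) v + G.totalShare I (3 * j + 1) (σ v)) := by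
    rw [← smul_eq_mul]
    refine Finset.card_nsmul_le_sum _ _ _ fun v hv => ?_
    obtain ⟨hy, ⟨hne, hlt⟩ | ⟨heq, hall⟩⟩ := hσ v hv
    · exact hI.le_totalShare_add hj hconn hreg hv hy hne.symm hlt
    · have := hI.le_totalShare hj hconn hreg hn hv hall
      rw [heq]
      omega
  rw [Finset.sum_add_distrib, hsum] at hle
  linarith

lemma IsFarFamily.card_mul_share_mul_le (hj : 0 < j) (hconn : G.Connected)
    (hreg : G.IsRegularOfDegree d) {I : Finset V} (hI : G.IsFarFamily d (2 * j) I) (w : V) :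
    (G.nearMembers I (3 * j + 1) w).card * G.share I (3 * j + 1) w * (d + 1) ≤ 2 * (d + 1) +
      4 * (2 * j + 1) * ((G.distBall w (3 * (2 * j))).card - (2 * j + 1) * (d + 1)) := by
  rcases lt_or_ge (G.nearMembers I (3 * j + 1) w).card 3 with h | h
  · refine le_add_right (Nat.mul_le_mul_right _ ?_)
    rw [share]
    split_ifs <;> omega
  · obtain ⟨rfl, h1⟩ := hI.card_nearMembers_add_one_mul_le hj hconn hreg h
    rw [share, if_neg (by omega)]
    obtain ⟨m, hm⟩ := Nat.exists_eq_add_of_le h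
    rw [hm] at h1 ⊢
    have h2 : (m + 1) * (d + 1) ≤
        (G.distBall w (3 * (2 * 1))).card - (2 * 1 + 1) * (d + 1) := by
      apply Nat.le_sub_of_add_le
      have : 3 * (2 * 1) = 6 := rfl
      rw [this]
      linarith
    nlinarith [Nat.zero_le (m * (d + 1))]

/-- The number of far apart small balls is controlled by the order of the graph and the total
excess of the large balls. -/
theorem IsFarFamily.card_mul_le (hconn : G.Connected) (hreg : G.IsRegularOfDegree d)
    (hk : 0 < k) (hn : (k + 1) * (d + 1) ≤ Fintype.card V) {I : Finset V}
    (hI : G.IsFarFamily d k I) :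
    I.card * ((k + 1) * (d + 1)) * (d + 1) ≤ 2 * Fintype.card V * (d + 1) +
      4 * (k + 1) * ∑ w, ((G.distBall w (3 * k)).card - (k + 1) * (d + 1)) := by
  rcases Nat.even_or_odd' k with ⟨j, rfl | rfl⟩
  · have hj : 0 < j := by omega
    calc I.card * ((2 * j + 1) * (d + 1)) * (d + 1)
        ≤ (∑ w, (G.nearMembers I (3 * j + 1) w).card * G.share I (3 * j + 1) w) * (d + 1) := by
          rw [← sum_totalShare]
          exact Nat.mul_le_mul_right _ (hI.card_mul_le_sum_totalShare hj hconn hreg hn)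
      _ ≤ ∑ w : V, (2 * (d + 1) + 4 * (2 * j + 1) *
            ((G.distBall w (3 * (2 * j))).card - (2 * j + 1) * (d + 1))) := by
          rw [Finset.sum_mul]
          exact Finset.sum_le_sum fun w _ => hI.card_mul_share_mul_le hj hconn hreg w
      _ = _ := by
          rw [Finset.sum_add_distrib, Finset.sum_const, Finset.card_univ, smul_eq_mul,
            ← Finset.mul_sum]
          ring
  · have := hI.card_mul_le_of_odd hconn hreg hn
    refine le_add_right (Nat.mul_le_mul_right _ ?_)
    linarith

end SimpleGraph

/-! ### Total deficit against total excess, and the average ball. -/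

namespace SimpleGraph

variable {V : Type*} [Fintype V] {G : SimpleGraph V} [DecidableRel G.Adj] {d k : ℕ}

/-- The total deficit of the small balls is controlled by the size of some far family. -/
theorem exists_isFarFamily_deficit_le (hk : 0 < k) (hconn : G.Connected)
    (hreg : G.IsRegularOfDegree d) (hn : (k + 1) * (d + 1) ≤ Fintype.card V) :
    ∃ I, G.IsFarFamily d k I ∧
      4 * ∑ w, ((k + 1) * (d + 1) - (G.distBall w (3 * k)).card) ≤ I.card * (d + 1) ^ 2 := by
  classical
  set S : Finset V := Finset.univ.filter fun v => G.HasSmallBall d k v with hS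
  have memS : ∀ {v}, v ∈ S ↔ G.HasSmallBall d k v := by simp [hS]
  -- A largest 3-separated set of small centres comes within 2 of every small centre.
  obtain ⟨I, hIF, hImax⟩ := Finset.exists_max_image
    (S.powerset.filter fun I => ∀ v ∈ I, ∀ y ∈ I, v ≠ y → 3 ≤ G.dist v y) Finset.card
    ⟨∅, by simp⟩
  rw [Finset.mem_filter, Finset.mem_powerset] at hIF
  obtain ⟨hIS, hI3⟩ := hIF
  have hcover : ∀ u ∈ S, ∃ v ∈ I, G.dist v u ≤ 2 := by
    intro u hu
    by_contra! hfar
    have huI : u ∉ I := fun h => by simpa using hfar u h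
    have hins := hImax (insert u I) (by
      rw [Finset.mem_filter, Finset.mem_powerset]
      refine ⟨Finset.insert_subset hu hIS, ?_⟩
      intro v hv y hy hvy
      rcases Finset.mem_insert.1 hv with rfl | hvI
      · rcases Finset.mem_insert.1 hy with rfl | hyI
        · exact absurd rfl hvy
        · rw [G.dist_comm]
          exact hfar y hyI
      · rcases Finset.mem_insert.1 hy with rfl | hyI
        · exact hfar v hvI
        · exact hI3 v hvI y hyI hvy)
    rw [Finset.card_insert_of_notMem huI] at hins
    omega
  refine ⟨I, ⟨fun v hv => memS.1 (hIS hv), hI3, fun v hv y hy hvy => ?_⟩, ?_⟩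
  · have h1 := hI3 v hv y hy hvy
    have h2 := (memS.1 (hIS hv)).dist_le_two_or hconn hreg hn (memS.1 (hIS hy))
    omega
  have hclass : ∀ v ∈ I, 4 * ∑ u ∈ S with G.dist v u ≤ 2,
      ((k + 1) * (d + 1) - (G.distBall u (3 * k)).card) ≤ (d + 1) ^ 2 := by
    intro v hv
    have hv' := memS.1 (hIS hv)
    have hbound : ∀ u ∈ S.filter fun u => G.dist v u ≤ 2,
        (k + 1) * (d + 1) - (G.distBall u (3 * k)).card ≤
          (d + 1) - (S.filter fun u => G.dist v u ≤ 2).card := by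
      intro u hu
      rw [Finset.mem_filter] at hu
      have huv : G.dist u v ≤ 2 := by rw [G.dist_comm]; exact hu.2
      have := (memS.1 hu.1).card_add_le_card_distBall hk hconn hreg hn
        (S.filter fun u => G.dist v u ≤ 2) fun x hx => by
          rw [Finset.mem_filter] at hx
          exact ⟨memS.1 hx.1, hv'.dist_le_two_trans hk hconn hreg hn (memS.1 hu.1)
            (memS.1 hx.1) huv hx.2⟩
      rw [Nat.add_mul k 1]
      omega
    have hsum := Finset.sum_le_card_nsmul _ _ _ hbound
    rw [smul_eq_mul] at hsum
    refine (Nat.mul_le_mul_left 4 hsum).trans ?_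
    generalize (S.filter fun u => G.dist v u ≤ 2).card = c
    rcases le_total (d + 1) c with h | h
    · simp [Nat.sub_eq_zero_of_le h]
    · obtain ⟨e, he⟩ := Nat.exists_eq_add_of_le h
      rw [he, Nat.add_sub_cancel_left]
      nlinarith [sq_nonneg ((c : ℤ) - e), four_mul_le_sq_add c e]
  calc 4 * ∑ w, ((k + 1) * (d + 1) - (G.distBall w (3 * k)).card)
      = 4 * ∑ w ∈ S, ((k + 1) * (d + 1) - (G.distBall w (3 * k)).card) := by
        congr 1
        refine (Finset.sum_subset (Finset.subset_univ S) fun w _ hw => ?_).symm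
        rw [memS, HasSmallBall, not_lt] at hw
        exact Nat.sub_eq_zero_of_le hw
    _ ≤ 4 * ∑ w ∈ S, ∑ v ∈ I, (if G.dist v w ≤ 2 then
          (k + 1) * (d + 1) - (G.distBall w (3 * k)).card else 0) := by
        refine Nat.mul_le_mul_left 4 (Finset.sum_le_sum fun w hw => ?_)
        obtain ⟨v, hv, hvw⟩ := hcover w hw
        refine le_trans ?_ (Finset.single_le_sum (fun _ _ => Nat.zero_le _) hv)
        rw [if_pos hvw]
    _ = ∑ v ∈ I, 4 * ∑ w ∈ S with G.dist v w ≤ 2,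
          ((k + 1) * (d + 1) - (G.distBall w (3 * k)).card) := by
        rw [Finset.sum_comm, Finset.mul_sum]
        simp only [Finset.sum_filter]
    _ ≤ I.card * (d + 1) ^ 2 := by
        rw [← smul_eq_mul (I.card)]
        exact Finset.sum_le_card_nsmul _ _ _ hclass

lemma mul_succ_le_card_of_le_diam (hconn : G.Connected) (hreg : G.IsRegularOfDegree d)
    (h : 3 * k ≤ G.diam) : (k + 1) * (d + 1) ≤ Fintype.card V := by
  obtain ⟨v, p, hp⟩ := exists_isGeodesicFrom_of_le_diam hconn h
  exact (hp.mul_succ_le_card_distBall hconn hreg le_rfl le_rfl).trans (Finset.card_le_univ _)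

/-- In radius at least `3 * k + 1` all balls are large. -/
lemma mul_succ_le_card_distBall_of_le_diam (hconn : G.Connected) (hreg : G.IsRegularOfDegree d)
    {r : ℕ} (hr : 3 * k + 1 ≤ r) (h : r ≤ G.diam) (v : V) :
    (k + 1) * (d + 1) ≤ (G.distBall v r).card := by
  rcases exists_isGeodesicFrom_or_distBall_eq_univ hconn v r with ⟨p, hp⟩ | h'
  · exact hp.mul_succ_le_card_distBall hconn hreg (by omega) hr
  · rw [h', Finset.card_univ]
    exact mul_succ_le_card_of_le_diam hconn hreg (by omega)

/-- The average size of the balls of radius `3 * k`. -/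
theorem card_mul_le_sum_card_distBall (hk : 0 < k) (hconn : G.Connected)
    (hreg : G.IsRegularOfDegree d) (h : 3 * k ≤ G.diam) :
    2 * (k + 1) ^ 2 * (Fintype.card V * (d + 1)) ≤
      2 * (k + 1) * ∑ v, (G.distBall v (3 * k)).card + Fintype.card V * (d + 1) := by
  have hn := mul_succ_le_card_of_le_diam hconn hreg h
  obtain ⟨I, hI, hdef⟩ := exists_isFarFamily_deficit_le hk hconn hreg hn
  have hex := hI.card_mul_le hconn hreg hk hn
  -- The truncated differences are the deficit and the excess of a ball; one of them is always zero.
  have hbal : ∑ v, (G.distBall v (3 * k)).card +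
      ∑ w, ((k + 1) * (d + 1) - (G.distBall w (3 * k)).card) =
      Fintype.card V * ((k + 1) * (d + 1)) +
        ∑ w, ((G.distBall w (3 * k)).card - (k + 1) * (d + 1)) := by
    rw [← Finset.sum_add_distrib, ← smul_eq_mul (Fintype.card V), ← Finset.card_univ,
      ← Finset.sum_const, ← Finset.sum_add_distrib]
    exact Finset.sum_congr rfl fun w _ => by omega
  have hdef' := Nat.mul_le_mul_left (k + 1) hdef
  have hbal' := congrArg (2 * (k + 1) * ·) hbal
  linarith

end SimpleGraph

/-! ### From ball sizes to edge counts. -/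

lemma two_mul_numEdges {V : Type*} [Fintype V] (H : SimpleGraph V) [DecidableRel H.Adj] :
    2 * numEdges H = ∑ v, H.degree v := by
  classical
  rw [H.sum_degrees_eq_twice_card_edges, numEdges, Set.ncard_eq_toFinset_card',
    SimpleGraph.edgeFinset]

lemma two_mul_numEdges_graphPower {V : Type*} [Fintype V] {G : SimpleGraph V}
    (hconn : G.Connected) (r : ℕ) :
    2 * numEdges (graphPower G r) + Fintype.card V = ∑ v, (G.distBall v r).card := by
  classical
  rw [two_mul_numEdges, ← Finset.card_univ, Finset.card_eq_sum_ones, ← Finset.sum_add_distrib]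
  refine Finset.sum_congr rfl fun v _ => ?_
  have hball : G.distBall v r = insert v ((graphPower G r).neighborFinset v) := by
    ext w
    have : G.edist v w ≤ r ↔ G.dist v w ≤ r := by
      rw [← (hconn v w).coe_dist_eq_edist, Nat.cast_le]
    rw [Finset.mem_insert, SimpleGraph.mem_neighborFinset, SimpleGraph.mem_distBall]
    change _ ↔ w = v ∨ (v ≠ w ∧ G.edist v w ≤ r)
    rw [this]
    by_cases hvw : v = w
    · simp [hvw]
    · simp [hvw, Ne.symm hvw]
  rw [hball, Finset.card_insert_of_notMem (by simp), SimpleGraph.card_neighborFinset_eq_degree]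

theorem theorem3 {V : Type*} [Fintype V] (G : SimpleGraph V) [DecidableRel G.Adj]
    (hconn : G.Connected) (d : ℕ) (hreg : G.IsRegularOfDegree d)
    (r : ℕ) (hr : 0 < r) (hdiam : r ≤ G.diam) :
    (r % 3 = 0 →
      ((r : ℝ) + 3) / 3 - 3 / (2 * ((r : ℝ) + 3)) ≤
        (numEdges (graphPower G r) : ℝ) / (numEdges G : ℝ)) ∧
    (r % 3 ≠ 0 →
      ((⌈(r : ℝ) / 3⌉ : ℤ) : ℝ) ≤
        (numEdges (graphPower G r) : ℝ) / (numEdges G : ℝ)) := by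
  have hnV : 0 < Fintype.card V := Fintype.card_pos_iff.2 hconn.nonempty
  have hd : 0 < d := by
    obtain ⟨v, p, hp⟩ := SimpleGraph.exists_isGeodesicFrom_of_le_diam hconn hdiam
    have hadj : G.Adj v (p 1) := SimpleGraph.dist_eq_one_iff_adj.1 (hp.dist_left hr)
    rw [← hreg v, G.degree_pos_iff_exists_adj]
    exact ⟨_, hadj⟩
  have heG : 2 * numEdges G = Fintype.card V * d := by
    rw [two_mul_numEdges, Finset.sum_congr rfl fun v _ => hreg v]
    simp
  have heP := two_mul_numEdges_graphPower hconn r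
  have hpos : (0 : ℝ) < numEdges G := by
    have : 0 < numEdges G := by
      have := Nat.mul_pos hnV hd
      omega
    exact_mod_cast this
  refine ⟨fun h0 => ?_, fun h0 => ?_⟩
  · obtain ⟨k, rfl⟩ : ∃ k, r = 3 * k := ⟨r / 3, by omega⟩
    have hk : 0 < k := by omega
    have hsum := SimpleGraph.card_mul_le_sum_card_distBall hk hconn hreg hdiam
    rw [← heP] at hsum
    rw [le_div_iff₀ hpos]
    have hk1 : (1 : ℝ) ≤ k := by exact_mod_cast hk
    have hsum' : 2 * ((k : ℝ) + 1) ^ 2 * (Fintype.card V * (d + 1)) ≤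
        2 * (k + 1) * (2 * numEdges (graphPower G (3 * k)) + Fintype.card V) +
          Fintype.card V * (d + 1) := by exact_mod_cast hsum
    have heG' : 2 * (numEdges G : ℝ) = Fintype.card V * d := by exact_mod_cast heG
    have hcoef : (((3 * k : ℕ) : ℝ) + 3) / 3 - 3 / (2 * (((3 * k : ℕ) : ℝ) + 3)) =
        (2 * ((k : ℝ) + 1) ^ 2 - 1) / (2 * (k + 1)) := by
      push_cast
      field_simp
    rw [hcoef, div_mul_eq_mul_div, div_le_iff₀ (by positivity)]
    -- The slack left when `d + 1` becomes `d` and each centre is removed from its ball.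
    have hn0 : (0 : ℝ) ≤ Fintype.card V * (2 * (k + 1) ^ 2 - 2 * (k + 1) - 1) :=
      mul_nonneg (Nat.cast_nonneg _) (by nlinarith)
    have e1 : 2 * ((2 * ((k : ℝ) + 1) ^ 2 - 1) * numEdges G) =
        (2 * ((k : ℝ) + 1) ^ 2 - 1) * (Fintype.card V * d) := by
      rw [← heG']
      ring
    linarith
  · obtain ⟨k, hk1, hk2⟩ : ∃ k, 3 * k + 1 ≤ r ∧ r ≤ 3 * k + 2 := ⟨r / 3, by omega, by omega⟩
    have hceil : ⌈(r : ℝ) / 3⌉ = (k : ℤ) + 1 := by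
      have h1 : (3 : ℝ) * k + 1 ≤ r := by exact_mod_cast hk1
      have h2 : (r : ℝ) ≤ 3 * k + 2 := by exact_mod_cast hk2
      rw [Int.ceil_eq_iff]
      push_cast
      constructor <;> linarith
    have hsum : Fintype.card V * ((k + 1) * (d + 1)) ≤ ∑ v, (G.distBall v r).card := by
      rw [← smul_eq_mul, ← Finset.card_univ]
      exact Finset.card_nsmul_le_sum _ _ _ fun v _ =>
        SimpleGraph.mul_succ_le_card_distBall_of_le_diam hconn hreg hk1 hdiam v
    rw [hceil, le_div_iff₀ hpos]
    rw [← heP] at hsum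
    have hmain : (k + 1) * numEdges G ≤ numEdges (graphPower G r) := by
      nlinarith [Nat.zero_le (Fintype.card V * k)]
    exact_mod_cast hmain
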